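/- Let $G=(V,E)$ be a finite undirected graph, with loops and multiple edges allowed. Its dichromatic polynomial is $$Z_G(q,v)=\sum_{E'\subseteq E} q^{k(E')}\,v^{|E'|},$$ where $k(E')$ is the number of connected components (including isolated vertices) of the subgraph $(V,E')$. For integers $n,r\ge 1$ let $C_n^{(r)}$ be the cycle $C_n$ of length $n$ with each edge replaced by $r$ edges in parallel. Theorem. Fix complex numbers $q_0,v_0$ satisfying $q_0\ne 0$, $q_0\neq 1$ and $|1+v_0|\ge 1$. Then, for each $\epsilon>0$, there exist a number $r_0<\infty$ and, for each $r$, a number $n_0(r)<\infty$ such that for all $r\ge r_0$ and $n\ge n_0(r)$, the polynomial $Z_{C_n^{(r)}}(q_0,\,\cdot\,)$ has a zero in the disc $|v-v_0|<\epsilon$. -/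

import Mathlib

open scoped Graph

/-- The cycle `C_n` as a multigraph: vertices `0, …, n - 1`, and for each `i` one edge joining `i`
to its cyclic successor (a loop for `n = 1`, two parallel edges for `n = 2`). -/
def cycleMultigraph (n : ℕ) : Graph (Fin n) (Fin n) where
  vertexSet := Set.univ
  IsLink i x y := (x = i ∧ y = finRotate n i) ∨ (y = i ∧ x = finRotate n i)
  isLink_symm := fun _ _ => ⟨fun _ _ h => h.symm⟩
  eq_or_eq_of_isLink_of_isLink := by
    rintro i x y z w (⟨rfl, rfl⟩ | ⟨rfl, rfl⟩) (⟨rfl, rfl⟩ | ⟨rfl, rfl⟩) <;> simp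
  left_mem_of_isLink := fun _ _ _ _ => Set.mem_univ _

/-- The graph obtained from `G` by replacing each edge by `r` edges in parallel. -/
def Graph.parallelExpansion {α β : Type*} (G : Graph α β) (r : ℕ) : Graph α (β × Fin r) where
  vertexSet := V(G)
  IsLink e x y := G.IsLink e.1 x y
  isLink_symm := fun _ _ => ⟨fun _ _ h => h.symm⟩
  eq_or_eq_of_isLink_of_isLink := fun _ _ _ _ _ h h' => h.left_eq_or_eq h'
  left_mem_of_isLink := fun _ _ _ h => h.left_mem

/-- The number of connected components (including isolated vertices) of a multigraph: the number
of classes of the equivalence relation on the vertices generated by adjacency. -/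
noncomputable def Graph.componentCount {α β : Type*} (G : Graph α β) : ℕ :=
  Nat.card (Quot fun x y : V(G) => G.Adj x.1 y.1)

open Classical in
/-- The Potts-model partition function of a finite multigraph with edge weights `v`:
the sum over `A ⊆ E(G)` of `q ^ k(A) * ∏ e ∈ A, v e`, where `k(A)` is the number of connected
components of the spanning subgraph with edge set `A`. -/
noncomputable def Graph.pottsPartition {α β : Type*} [Finite α] [Fintype β] (G : Graph α β)
    (q : ℂ) (v : β → ℂ) : ℂ :=
  ∑ A ∈ E(G).toFinset.powerset, q ^ (G.restrict (A : Set β)).componentCount * ∏ e ∈ A, v e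

/-- The dichromatic polynomial `Z_G(q, v)`: all edge weights are equal to `v`. -/
noncomputable def Graph.dichromatic {α β : Type*} [Finite α] [Fintype β] (G : Graph α β)
    (q v : ℂ) : ℂ :=
  G.pottsPartition q fun _ => v

/-!
Replacing an edge by `r` parallel edges of weight `v` has the same effect as giving it the single
weight `w = (1 + v) ^ r - 1`, and `Z_{C_n}(q, w) = (q + w) ^ n + (q - 1) w ^ n`. For `q ≠ 0, 1` the
zeros of the latter in `w` accumulate, as `n → ∞`, at every point of the equimodular line
`|q + w| = |w|`, because the solutions `t` of `t ^ n = 1 - q` accumulate at every point of the unit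
circle. This line meets every large circle around `-1`. A number `z₀` close to `1 + v₀` with
`|z₀| > 1` has `|z₀| ^ r → ∞`, so for large `r` there is a `z` with `|z| = |z₀|` and `z ^ r - 1` on
the line, and `z` can be chosen within `π |z₀| / r` of `z₀` by taking the right `r`-th root.
-/

open Finset Filter Topology

section StepAdj

variable {α : Type*} {s : α → α} {B : Set α}

/-- The adjacency relation of the graph of the map `s` (an edge joins each `x` to `s x`), restricted
to the edges that start in `B`. For `s` a cyclic rotation these are the spanning subgraphs of a
cycle. -/
def StepAdj (s : α → α) (B : Set α) (x y : α) : Prop :=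
  (x ∈ B ∧ y = s x) ∨ (y ∈ B ∧ x = s y)

theorem quot_mk_stepAdj_iterate {k : ℕ} {x : α} (h : ∀ j < k, s^[j] x ∈ B) :
    Quot.mk (StepAdj s B) (s^[k] x) = Quot.mk (StepAdj s B) x := by
  induction k with
  | zero => rfl
  | succ k ih =>
    rw [Function.iterate_succ_apply', ← ih fun j hj => h j (hj.trans k.lt_succ_self)]
    exact Quot.sound (Or.inr ⟨h k k.lt_succ_self, rfl⟩)

theorem card_quot_stepAdj_univ [Nonempty α] (h : ∀ x y, ∃ k, s^[k] x = y) :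
    Nat.card (Quot (StepAdj s Set.univ)) = 1 := by
  rw [Nat.card_eq_one_iff_unique]
  refine ⟨⟨?_⟩, ‹Nonempty α›.map (Quot.mk _)⟩
  rintro ⟨x⟩ ⟨y⟩
  obtain ⟨k, rfl⟩ := h x y
  exact (quot_mk_stepAdj_iterate fun _ _ => Set.mem_univ _).symm

open Classical in
/-- The first point outside `B` on the forward `s`-orbit of `x`. It is the canonical representative
of the component of `x` under `StepAdj s B`. -/
noncomputable def exitPoint (h : ∀ x, ∃ k, s^[k] x ∉ B) (x : α) : α :=
  s^[Nat.find (h x)] x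

theorem exitPoint_notMem (h : ∀ x, ∃ k, s^[k] x ∉ B) (x : α) : exitPoint h x ∉ B := by
  classical exact Nat.find_spec (h x)

theorem exitPoint_of_notMem (h : ∀ x, ∃ k, s^[k] x ∉ B) {x : α} (hx : x ∉ B) :
    exitPoint h x = x := by
  classical
  rw [exitPoint, (Nat.find_eq_zero (h x)).2 hx, Function.iterate_zero_apply]

theorem exitPoint_apply_of_mem (h : ∀ x, ∃ k, s^[k] x ∉ B) {x : α} (hx : x ∈ B) :
    exitPoint h (s x) = exitPoint h x := by
  classical
  have hfind : Nat.find (h x) = Nat.find (h (s x)) + 1 :=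
    Nat.find_comp_succ (h x) (h (s x)) (not_not.2 hx)
  rw [exitPoint, exitPoint, hfind, Function.iterate_succ_apply]

theorem quot_mk_exitPoint (h : ∀ x, ∃ k, s^[k] x ∉ B) (x : α) :
    Quot.mk (StepAdj s B) (exitPoint h x) = Quot.mk (StepAdj s B) x := by
  classical exact quot_mk_stepAdj_iterate fun j hj => not_not.1 (Nat.find_min (h x) hj)

theorem exitPoint_eq_of_stepAdj (h : ∀ x, ∃ k, s^[k] x ∉ B) {x y : α} (hxy : StepAdj s B x y) :
    exitPoint h x = exitPoint h y := by
  rcases hxy with ⟨hx, rfl⟩ | ⟨hy, rfl⟩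
  · exact (exitPoint_apply_of_mem h hx).symm
  · exact exitPoint_apply_of_mem h hy

theorem card_quot_stepAdj_of_exits (h : ∀ x, ∃ k, s^[k] x ∉ B) :
    Nat.card (Quot (StepAdj s B)) = Nat.card (Bᶜ : Set α) :=
  Nat.card_congr
    { toFun := Quot.lift (fun x => ⟨exitPoint h x, exitPoint_notMem h x⟩)
        fun _ _ hxy => Subtype.ext (exitPoint_eq_of_stepAdj h hxy)
      invFun := fun x => Quot.mk _ x
      left_inv := by rintro ⟨x⟩; exact quot_mk_exitPoint h x
      right_inv := fun x => Subtype.ext (exitPoint_of_notMem h x.2) }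

end StepAdj

section Cycle

variable {n : ℕ}

theorem exists_finRotate_iterate_eq (x y : Fin n) : ∃ k, (finRotate n)^[k] x = y := by
  have : NeZero n := x.neZero
  exact ⟨(y - x).val, by rw [← finCycle_eq_finRotate_iterate, finCycle_apply, add_sub_cancel]⟩

theorem componentCount_restrict_cycleMultigraph (B : Set (Fin n)) :
    ((cycleMultigraph n).restrict B).componentCount =
      Nat.card (Quot (StepAdj (finRotate n) B)) := by
  refine Nat.card_congr (Quot.congr (Equiv.subtypeUnivEquiv fun _ => Set.mem_univ _) ?_)
  rintro ⟨x, -⟩ ⟨y, -⟩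
  constructor
  · rintro ⟨i, hi, ⟨rfl, h⟩ | ⟨rfl, h⟩⟩
    · exact Or.inl ⟨hi, h⟩
    · exact Or.inr ⟨hi, h⟩
  · rintro (⟨hx, h⟩ | ⟨hy, h⟩)
    · exact ⟨x, hx, Or.inl ⟨rfl, h⟩⟩
    · exact ⟨y, hy, Or.inr ⟨rfl, h⟩⟩

theorem componentCount_restrict_cycleMultigraph_univ (hn : n ≠ 0) :
    ((cycleMultigraph n).restrict Set.univ).componentCount = 1 := by
  have : NeZero n := ⟨hn⟩
  rw [componentCount_restrict_cycleMultigraph, card_quot_stepAdj_univ exists_finRotate_iterate_eq]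

theorem componentCount_restrict_cycleMultigraph_of_ne_univ {A : Finset (Fin n)} (hA : A ≠ univ) :
    ((cycleMultigraph n).restrict (A : Set (Fin n))).componentCount = #Aᶜ := by
  obtain ⟨i, hi⟩ : ∃ i, i ∉ A := by simpa [Finset.eq_univ_iff_forall] using hA
  rw [componentCount_restrict_cycleMultigraph, card_quot_stepAdj_of_exits, ← coe_compl,
    Nat.card_coe_set_eq, Set.ncard_coe_finset]
  intro x
  obtain ⟨k, hk⟩ := exists_finRotate_iterate_eq x i
  exact ⟨k, by rwa [hk, mem_coe]⟩

theorem pottsPartition_cycleMultigraph (hn : n ≠ 0) (q : ℂ) (w : Fin n → ℂ) :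
    (cycleMultigraph n).pottsPartition q w = ∏ i, (q + w i) + (q - 1) * ∏ i, w i := by
  have hE : E(cycleMultigraph n) = Set.univ :=
    Set.eq_univ_of_forall fun i => ⟨i, finRotate n i, Or.inl ⟨rfl, rfl⟩⟩
  -- A forest of paths has one component per missing edge; only the full cycle deviates.
  have hcount (A : Finset (Fin n)) :
      q ^ ((cycleMultigraph n).restrict (A : Set (Fin n))).componentCount =
        q ^ #Aᶜ + if A = univ then q - 1 else 0 := by
    split_ifs with hA
    · simp [hA, componentCount_restrict_cycleMultigraph_univ hn]
    · rw [componentCount_restrict_cycleMultigraph_of_ne_univ hA, add_zero]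
  simp only [Graph.pottsPartition, hE, Set.toFinset_univ, powerset_univ, hcount, add_mul,
    sum_add_distrib, ite_mul, zero_mul, sum_ite_eq', mem_univ, if_true]
  simp_rw [add_comm q, Fintype.prod_add, prod_const, mul_comm]

end Cycle

section ParallelExpansion

variable {α β γ : Type*}

theorem mem_edgeSet_parallelExpansion {G : Graph α β} {r : ℕ} {e : β × Fin r} :
    e ∈ E(G.parallelExpansion r) ↔ e.1 ∈ E(G) := by
  simp only [Graph.edge_mem_iff_exists_isLink]
  rfl

theorem componentCount_restrict_parallelExpansion (G : Graph α β) {r : ℕ} (A : Set (β × Fin r)) :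
    ((G.parallelExpansion r).restrict A).componentCount =
      (G.restrict (Prod.fst '' A)).componentCount := by
  refine Nat.card_congr (Quot.congr (Equiv.refl _) fun x y => ⟨?_, ?_⟩)
  · rintro ⟨e, he, h⟩
    exact ⟨e.1, Set.mem_image_of_mem _ he, h⟩
  · rintro ⟨_, ⟨e, he, rfl⟩, h⟩
    exact ⟨e, he, h⟩

theorem sum_nonempty_prod_eq {R : Type*} [CommRing R] [Fintype γ] (v : γ → R) :
    ∑ S : Finset γ with S.Nonempty, ∏ j ∈ S, v j = ∏ j, (1 + v j) - 1 := by
  classical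
  have herase : ({S : Finset γ | S.Nonempty} : Finset (Finset γ)) = univ.erase ∅ := by
    ext S
    simp [nonempty_iff_ne_empty]
  rw [herase, sum_erase_eq_sub (mem_univ _), prod_one_add, powerset_univ, prod_empty]

theorem sum_prod_image_fst_eq {R : Type*} [CommRing R] [Fintype β] [Fintype γ] [DecidableEq β]
    (v : β × γ → R) (B : Finset β) :
    ∑ A : Finset (β × γ) with A.image Prod.fst = B, ∏ e ∈ A, v e =
      ∏ i ∈ B, (∏ j, (1 + v (i, j)) - 1) := by
  classical
  have hfactor (i : β) : (if i ∈ B then ∏ j, (1 + v (i, j)) - 1 else 1) =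
      ∑ S : Finset γ with (S.Nonempty ↔ i ∈ B), ∏ j ∈ S, v (i, j) := by
    split_ifs with hi
    · simp only [hi, iff_true, sum_nonempty_prod_eq]
    · simp [hi, filter_eq']
  rw [← Fintype.prod_ite_mem, prod_congr rfl fun i _ => hfactor i, prod_univ_sum]
  refine sum_nbij' (fun A i => {j | (i, j) ∈ A}) (fun f => univ.filter fun e => e.2 ∈ f e.1)
    ?_ ?_ ?_ ?_ ?_
  · intro A hA
    obtain rfl := (mem_filter.1 hA).2
    simp [Finset.Nonempty]
  · intro f hf
    refine mem_filter.2 ⟨mem_univ _, ?_⟩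
    ext i
    simpa [Finset.Nonempty] using (mem_filter.1 (Fintype.mem_piFinset.1 hf i)).2
  · intro A _
    ext e
    simp
  · intro f _
    ext i j
    simp
  · intro A _
    exact prod_finset_product _ _ _ (by simp)

theorem pottsPartition_parallelExpansion [Finite α] [Fintype β] (G : Graph α β) (r : ℕ) (q : ℂ)
    (v : β × Fin r → ℂ) :
    (G.parallelExpansion r).pottsPartition q v =
      G.pottsPartition q fun e => ∏ j, (1 + v (e, j)) - 1 := by
  classical
  have hmem (A : Finset (β × Fin r)) : A ∈ E(G.parallelExpansion r).toFinset.powerset ↔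
      A.image Prod.fst ∈ E(G).toFinset.powerset := by
    rw [mem_powerset, mem_powerset, image_subset_iff]
    simp only [subset_iff, Set.mem_toFinset, mem_edgeSet_parallelExpansion]
  simp only [Graph.pottsPartition]
  rw [← sum_fiberwise_of_maps_to fun A hA => (hmem A).1 hA]
  refine sum_congr rfl fun B hB => ?_
  rw [← sum_prod_image_fst_eq, mul_sum]
  refine sum_congr ?_ fun A hA => ?_
  · ext A
    simp only [mem_filter, mem_univ, true_and, hmem]
    exact and_iff_right_of_imp fun h => h ▸ hB
  · rw [componentCount_restrict_parallelExpansion, ← coe_image, (mem_filter.1 hA).2]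

end ParallelExpansion

theorem dichromatic_parallelExpansion_cycleMultigraph {n : ℕ} (hn : n ≠ 0) (r : ℕ) (q v : ℂ) :
    ((cycleMultigraph n).parallelExpansion r).dichromatic q v =
      (q + ((1 + v) ^ r - 1)) ^ n + (q - 1) * ((1 + v) ^ r - 1) ^ n := by
  simp [Graph.dichromatic, pottsPartition_parallelExpansion, pottsPartition_cycleMultigraph hn]

section Roots

theorem exists_pow_eq_norm_sub_le {n : ℕ} (hn : n ≠ 0) {y z : ℂ} (h : ‖y‖ = ‖z‖ ^ n) :
    ∃ x : ℂ, x ^ n = y ∧ ‖x - z‖ ≤ ‖z‖ * (Real.pi / n) := by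
  set θ := (y / z ^ n).arg
  have hy : y = z ^ n * Complex.exp (θ * Complex.I) := by
    rcases eq_or_ne z 0 with rfl | hz
    · simpa [hn] using h
    · have hunit : ‖y / z ^ n‖ = 1 := by
        rw [norm_div, norm_pow, h, div_self (pow_ne_zero n (norm_ne_zero_iff.2 hz))]
      have := Complex.norm_mul_exp_arg_mul_I (y / z ^ n)
      rw [hunit, Complex.ofReal_one, one_mul] at this
      rw [this, mul_div_cancel₀ _ (pow_ne_zero n hz)]
  refine ⟨z * Complex.exp (Complex.I * (θ / n : ℝ)), ?_, ?_⟩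
  · rw [hy, mul_pow, ← Complex.exp_nat_mul]
    congr 2
    push_cast
    field_simp
  · calc ‖z * Complex.exp (Complex.I * (θ / n : ℝ)) - z‖
        = ‖z‖ * ‖Complex.exp (Complex.I * (θ / n : ℝ)) - 1‖ := by rw [← norm_mul, mul_sub_one]
      _ ≤ ‖z‖ * ‖θ / n‖ := by gcongr; exact Real.norm_exp_I_mul_ofReal_sub_one_le
      _ ≤ ‖z‖ * (Real.pi / n) := by
        rw [Real.norm_eq_abs, abs_div, Nat.abs_cast]
        gcongr
        exact Complex.abs_arg_le_pi _

theorem exists_pow_eq_one_tendsto {t : ℂ} (ht : ‖t‖ = 1) :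
    ∃ ζ : ℕ → ℂ, (∀ n ≠ 0, ζ n ^ n = 1) ∧ Tendsto ζ atTop (𝓝 t) := by
  choose! ζ hζ hζt using fun (n : ℕ) (hn : n ≠ 0) =>
    exists_pow_eq_norm_sub_le hn (y := 1) (z := t) (by simp [ht])
  refine ⟨ζ, hζ, tendsto_iff_norm_sub_tendsto_zero.2 ?_⟩
  refine squeeze_zero' (Eventually.of_forall fun _ => norm_nonneg _) ?_
    (tendsto_const_div_atTop_nhds_zero_nat Real.pi)
  filter_upwards [eventually_ne_atTop 0] with n hn
  simpa [ht] using hζt n hn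

theorem exists_pow_eq_tendsto {a t : ℂ} (ha : a ≠ 0) (ht : ‖t‖ = 1) :
    ∃ z : ℕ → ℂ, (∀ n ≠ 0, z n ^ n = a) ∧ Tendsto z atTop (𝓝 t) := by
  obtain ⟨ζ, hζ, hζt⟩ := exists_pow_eq_one_tendsto ht
  refine ⟨fun n => a ^ (n⁻¹ : ℂ) * ζ n, fun n hn => ?_, ?_⟩
  · rw [mul_pow, hζ n hn, mul_one, Complex.cpow_nat_inv_pow a hn]
  · have hroot : Tendsto (fun n : ℕ => a ^ (n⁻¹ : ℂ)) atTop (𝓝 1) := by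
      simpa using (tendsto_inv_atTop_nhds_zero_nat (𝕜 := ℂ)).const_cpow (Or.inl ha)
    simpa using hroot.mul hζt

end Roots

theorem exists_norm_add_smul_eq {E : Type*} [NormedAddCommGroup E] [NormedSpace ℝ E] {x v : E}
    (hv : v ≠ 0) {M : ℝ} (hM : ‖x‖ ≤ M) : ∃ s : ℝ, ‖x + s • v‖ = M := by
  have hcont : Continuous fun s : ℝ => ‖x + s • v‖ := by fun_prop
  refine mem_range_of_exists_le_of_exists_ge hcont ⟨0, by simpa⟩ ?_
  have hM0 : 0 ≤ M := (norm_nonneg x).trans hM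
  have hlong : ‖((M + ‖x‖) / ‖v‖) • v‖ = M + ‖x‖ := by
    rw [norm_smul, Real.norm_of_nonneg (by positivity), div_mul_cancel₀ _ (norm_ne_zero_iff.2 hv)]
  have htriangle := norm_sub_le (x + ((M + ‖x‖) / ‖v‖) • v) x
  rw [add_sub_cancel_left, hlong] at htriangle
  exact ⟨(M + ‖x‖) / ‖v‖, by linarith⟩

section Equimodular

variable {q : ℂ}

theorem exists_equimodular_norm_one_add_eq (hq : q ≠ 0) {M : ℝ} (hM : ‖1 - q / 2‖ ≤ M) :
    ∃ w : ℂ, ‖q + w‖ = ‖w‖ ∧ ‖1 + w‖ = M := by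
  obtain ⟨s, hs⟩ := exists_norm_add_smul_eq (mul_ne_zero Complex.I_ne_zero hq) hM
  refine ⟨-q / 2 + s • (Complex.I * q), ?_, by rw [← hs]; congr 1; ring⟩
  set d : ℂ := 1 / 2 + s * Complex.I with hd
  have hconj : starRingEnd ℂ d = 1 / 2 - s * Complex.I := by
    apply Complex.ext <;> norm_num [hd]
  calc ‖q + (-q / 2 + s • (Complex.I * q))‖ = ‖d * q‖ := by
        congr 1; rw [hd, Complex.real_smul]; ring
    _ = ‖-starRingEnd ℂ d * q‖ := by rw [norm_mul, norm_mul, norm_neg, RCLike.norm_conj]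
    _ = ‖-q / 2 + s • (Complex.I * q)‖ := by
        congr 1; rw [hconj, Complex.real_smul]; ring

theorem exists_tendsto_add_pow_eq_mul_pow (hq : q ≠ 0) {a w : ℂ} (ha : a ≠ 0)
    (hw : ‖q + w‖ = ‖w‖) :
    ∃ x : ℕ → ℂ, Tendsto x atTop (𝓝 w) ∧ ∀ᶠ n in atTop, (q + x n) ^ n = a * x n ^ n := by
  have hw0 : w ≠ 0 := by
    rintro rfl
    simp [hq] at hw
  -- `t = (q + w) / w` is inverted by `w = q / (t - 1)`.
  have hunit : ‖(q + w) / w‖ = 1 := by rw [norm_div, hw, div_self (norm_ne_zero_iff.2 hw0)]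
  have hsub : (q + w) / w - 1 = q / w := by field_simp; ring
  have hsub0 : (q + w) / w - 1 ≠ 0 := hsub ▸ div_ne_zero hq hw0
  obtain ⟨t, ht, hlim⟩ := exists_pow_eq_tendsto ha hunit
  have hlim' : Tendsto (fun n => t n - 1) atTop (𝓝 ((q + w) / w - 1)) := hlim.sub_const 1
  refine ⟨fun n => q / (t n - 1), ?_, ?_⟩
  · have := (tendsto_const_nhds (x := q)).div hlim' hsub0
    rwa [hsub, div_div_cancel₀ hq] at this
  · filter_upwards [hlim'.eventually_ne hsub0, eventually_ne_atTop 0] with n htn hn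
    have : q + q / (t n - 1) = t n * (q / (t n - 1)) := by field_simp; ring
    rw [this, mul_pow, ht n hn]

theorem eventually_exists_dichromatic_eq_zero_of_equimodular (hq₀ : q ≠ 0) (hq₁ : q ≠ 1) {r : ℕ}
    (hr : r ≠ 0) {v : ℂ} (hv : 1 + v ≠ 0)
    (hequi : ‖q + ((1 + v) ^ r - 1)‖ = ‖(1 + v) ^ r - 1‖) {U : Set ℂ} (hU : U ∈ 𝓝 v) :
    ∀ᶠ n in atTop, ∃ x ∈ U, ((cycleMultigraph n).parallelExpansion r).dichromatic q x = 0 := by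
  obtain ⟨w, hw, hzero⟩ :=
    exists_tendsto_add_pow_eq_mul_pow hq₀ (sub_ne_zero.2 hq₁.symm) hequi
  have hderiv : HasStrictDerivAt (fun x : ℂ => (1 + x) ^ r - 1) (r * (1 + v) ^ (r - 1) * 1) v :=
    (((hasStrictDerivAt_id v).const_add 1).pow r).sub_const 1
  have himage : (fun x : ℂ => (1 + x) ^ r - 1) '' U ∈ 𝓝 ((1 + v) ^ r - 1) := by
    rw [← hderiv.map_nhds_eq (by simp [hr, hv])]
    exact image_mem_map hU
  filter_upwards [hw.eventually_mem himage, hzero, eventually_ne_atTop 0] with n ⟨x, hxU, hx⟩ hn hn0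
  refine ⟨x, hxU, ?_⟩
  rw [dichromatic_parallelExpansion_cycleMultigraph hn0, show (1 + x) ^ r - 1 = w n from hx, hn]
  ring

theorem eventually_exists_equimodular (hq : q ≠ 0) {v₀ : ℂ} (hv₀ : 1 ≤ ‖1 + v₀‖) {ε : ℝ}
    (hε : 0 < ε) :
    ∀ᶠ r : ℕ in atTop, ∃ v : ℂ, ‖v - v₀‖ < ε ∧ 1 + v ≠ 0 ∧
      ‖q + ((1 + v) ^ r - 1)‖ = ‖(1 + v) ^ r - 1‖ := by
  obtain ⟨z₀, hz₀, hdist⟩ : ∃ z₀ : ℂ, 1 < ‖z₀‖ ∧ ‖z₀ - (1 + v₀)‖ < ε / 2 := by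
    have hmem : 1 + v₀ ∈ closure (Metric.closedBall (0 : ℂ) 1)ᶜ := by
      rw [closure_compl, interior_closedBall _ one_ne_zero]
      simpa using hv₀
    obtain ⟨z₀, hz₀, hdist⟩ := Metric.mem_closure_iff.1 hmem (ε / 2) (half_pos hε)
    exact ⟨z₀, by simpa using hz₀, by rwa [dist_comm, dist_eq_norm] at hdist⟩
  have hlarge := (tendsto_pow_atTop_atTop_of_one_lt hz₀).eventually_ge_atTop ‖1 - q / 2‖
  have hclose : ∀ᶠ r : ℕ in atTop, ‖z₀‖ * (Real.pi / r) < ε / 2 := by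
    have := (tendsto_const_div_atTop_nhds_zero_nat Real.pi).const_mul ‖z₀‖
    rw [mul_zero] at this
    exact this.eventually_lt_const (half_pos hε)
  filter_upwards [hlarge, hclose, eventually_ne_atTop 0] with r hlarge hclose hr
  obtain ⟨w, hequi, hw⟩ := exists_equimodular_norm_one_add_eq hq hlarge
  obtain ⟨z, hz, hzz₀⟩ := exists_pow_eq_norm_sub_le hr hw
  refine ⟨z - 1, ?_, ?_, ?_⟩
  · calc ‖z - 1 - v₀‖ = ‖(z - z₀) + (z₀ - (1 + v₀))‖ := by congr 1; ring
      _ ≤ ‖z - z₀‖ + ‖z₀ - (1 + v₀)‖ := norm_add_le _ _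
      _ < ε := by linarith
  · rw [add_sub_cancel]
    rintro rfl
    rw [zero_pow hr] at hz
    rw [← hz, norm_zero] at hw
    exact (pow_pos (one_pos.trans hz₀) r).ne hw
  · rwa [add_sub_cancel, hz, add_sub_cancel_left]

end Equimodular

theorem theorem7p1 (q₀ v₀ : ℂ) (hq₀ : q₀ ≠ 0) (hq₁ : q₀ ≠ 1) (hv₀ : 1 ≤ ‖1 + v₀‖)
    (ε : ℝ) (hε : 0 < ε) :
    ∃ (r₀ : ℕ) (n₀ : ℕ → ℕ), ∀ r : ℕ, r₀ ≤ r → ∀ n : ℕ, n₀ r ≤ n →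
      ∃ v : ℂ, ‖v - v₀‖ < ε ∧
        ((cycleMultigraph n).parallelExpansion r).dichromatic q₀ v = 0 := by
  have hzeros : ∀ᶠ r in atTop, ∀ᶠ n in atTop, ∃ v : ℂ, ‖v - v₀‖ < ε ∧
      ((cycleMultigraph n).parallelExpansion r).dichromatic q₀ v = 0 := by
    filter_upwards [eventually_exists_equimodular hq₀ hv₀ hε, eventually_ne_atTop 0]
      with r ⟨v, hv, hv1, hequi⟩ hr
    have hball : Metric.ball v₀ ε ∈ 𝓝 v := Metric.isOpen_ball.mem_nhds (by rwa [mem_ball_iff_norm])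
    simpa only [mem_ball_iff_norm] using
      eventually_exists_dichromatic_eq_zero_of_equimodular hq₀ hq₁ hr hv1 hequi hball
  simp only [eventually_atTop] at hzeros
  obtain ⟨r₀, hr₀⟩ := hzeros
  choose! n₀ hn₀ using hr₀
  exact ⟨r₀, n₀, hn₀⟩
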